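/- Let $p,q,r,p',q',r'\ge 0$ be integers with $p+r=p'+r'$ and $q+r=q'+r'$, and put $L:=r-r'$. Let $K=\mathbb C(x,y)$, let $W(x,y)$ be the ring of differential operators in $x,y$ with coefficients in $K$, and put $\vartheta_x=x\partial_x$, $\vartheta_y=y\partial_y$. For $\boldsymbol\alpha\in\mathbb C^{p}$, $\boldsymbol\beta\in\mathbb C^{q}$, $\boldsymbol\gamma\in\mathbb C^{r}$, $\boldsymbol\alpha'\in\mathbb C^{p'}$, $\boldsymbol\beta'\in\mathbb C^{q'}$, $\boldsymbol\gamma'\in\mathbb C^{r'}$ let $\mathcal M^{\boldsymbol\alpha,\boldsymbol\beta,\boldsymbol\gamma}_{\boldsymbol\alpha',\boldsymbol\beta',\boldsymbol\gamma'}$ be the system $P_1u=P_2u=P_{12}u=0$, where $$\begin{aligned} P_1&=(\vartheta_x-\boldsymbol\alpha')(\vartheta_x+\vartheta_y-\boldsymbol\gamma')-x(\vartheta_x+\boldsymbol\alpha)(\vartheta_x+\vartheta_y+\boldsymbol\gamma),\\ P_2&=(\vartheta_y-\boldsymbol\beta')(\vartheta_x+\vartheta_y-\boldsymbol\gamma')-y(\vartheta_y+\boldsymbol\beta)(\vartheta_x+\vartheta_y+\boldsymbol\gamma),\\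 P_{12}&=x(\vartheta_x+\boldsymbol\alpha)(\vartheta_y-\boldsymbol\beta')-y(\vartheta_y+\boldsymbol\beta)(\vartheta_x-\boldsymbol\alpha'), \end{aligned}$$ with the convention $(T\pm\boldsymbol a):=\prod_{i=1}^{n}(T\pm a_i)$ for $\boldsymbol a=(a_1,\dots,a_n)\in\mathbb C^n$ (an empty product is $1$). Its rank is defined as $$\operatorname{rank}\mathcal M^{\boldsymbol\alpha,\boldsymbol\beta,\boldsymbol\gamma}_{\boldsymbol\alpha',\boldsymbol\beta',\boldsymbol\gamma'}:=\dim_K W(x,y)/\bigl(W(x,y)P_1+W(x,y)P_2+W(x,y)P_{12}\bigr).$$ Then, for all values of the parameters $\boldsymbol\alpha,\boldsymbol\beta,\boldsymbol\gamma,\boldsymbol\alpha',\boldsymbol\beta',\boldsymbol\gamma'$, this rank is finite and $$\operatorname{rank}\mathcal M^{\boldsymbol\alpha,\boldsymbol\beta,\boldsymbol\gamma}_{\boldsymbol\alpha',\boldsymbol\beta',\boldsymbol\gamma'}=\begin{cases}\dfrac{p'q'r-pqr'}{L}&(L\neq0),\\[1ex] pq+qr+rp&(L=0).\end{cases}$$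 -/

import Mathlib

namespace HGSystem

open TrivSqZeroExt

noncomputable section

/-- The polynomial ring `ℂ[x, y]`; the variables are `X 0 = x` and `X 1 = y`. -/
abbrev Poly2 : Type := MvPolynomial (Fin 2) ℂ

/-- The field `K = ℂ(x, y)` of rational functions in two variables. -/
abbrev Rat2 : Type := FractionRing Poly2

/-- The coordinate function `x` (for `i = 0`) or `y` (for `i = 1`) as an element of `K`. -/
def coord (i : Fin 2) : Rat2 := algebraMap Poly2 Rat2 (MvPolynomial.X i)

/-- The algebra map `ℂ[x, y] → K[ε]`, `ε² = 0`, `a ↦ a + (∂ᵢ a) ε`. -/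
def polyToDual (i : Fin 2) : Poly2 →ₐ[ℂ] TrivSqZeroExt Rat2 Rat2 :=
  MvPolynomial.aeval fun j => inl (coord j) + inr (if j = i then 1 else 0)

theorem fst_polyToDual (i : Fin 2) (a : Poly2) :
    (polyToDual i a).fst = algebraMap Poly2 Rat2 a := by
  have h : (fstHom ℂ Rat2 Rat2).comp (polyToDual i) = IsScalarTower.toAlgHom ℂ Poly2 Rat2 := by
    apply MvPolynomial.algHom_ext
    intro j
    by_cases hj : j = i <;> simp [polyToDual, coord, hj]
  exact DFunLike.congr_fun h a

theorem isUnit_polyToDual (i : Fin 2) (s : nonZeroDivisors Poly2) :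
    IsUnit (polyToDual i (s : Poly2)) := by
  rw [isUnit_iff_isUnit_fst, fst_polyToDual]
  exact IsLocalization.map_units Rat2 s

/-- The extension of `polyToDual` to `K → K[ε]`, `f ↦ f + (∂ᵢ f) ε`. -/
def ratToDual (i : Fin 2) : Rat2 →ₐ[ℂ] TrivSqZeroExt Rat2 Rat2 :=
  IsLocalization.liftAlgHom (M := nonZeroDivisors Poly2) (isUnit_polyToDual i)

theorem ratToDual_algebraMap (i : Fin 2) (a : Poly2) :
    ratToDual i (algebraMap Poly2 Rat2 a) = polyToDual i a := by
  simp [ratToDual]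

theorem fst_ratToDual (i : Fin 2) (f : Rat2) : (ratToDual i f).fst = f := by
  have h : (fstHom ℂ Rat2 Rat2).comp (ratToDual i) = AlgHom.id ℂ Rat2 := by
    apply IsLocalization.algHom_ext (nonZeroDivisors Poly2)
    refine AlgHom.ext fun a => ?_
    change (ratToDual i (algebraMap Poly2 Rat2 a)).fst = algebraMap Poly2 Rat2 a
    rw [ratToDual_algebraMap, fst_polyToDual]
  exact DFunLike.congr_fun h f

/-- The partial derivative `∂/∂x` (for `i = 0`) or `∂/∂y` (for `i = 1`) on `K = ℂ(x, y)`. -/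
def partialD (i : Fin 2) : Derivation ℂ Rat2 Rat2 :=
  Derivation.mk' ((sndHom Rat2 Rat2).restrictScalars ℂ ∘ₗ (ratToDual i).toLinearMap) <| by
    intro f g
    simp [fst_ratToDual, snd_mul, mul_comm]

/-- `partialD` extends the formal partial derivative of polynomials. Together with the quotient
rule, which holds for every derivation, this determines it. -/
theorem partialD_algebraMap (i : Fin 2) (a : Poly2) :
    partialD i (algebraMap Poly2 Rat2 a) = algebraMap Poly2 Rat2 (MvPolynomial.pderiv i a) := by
  have h : (partialD i).compAlgebraMap Poly2 =
      (Algebra.linearMap Poly2 Rat2).compDer (MvPolynomial.pderiv i) := by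
    apply MvPolynomial.derivation_ext
    intro j
    have h1 : partialD i (algebraMap Poly2 Rat2 (MvPolynomial.X j)) = if j = i then 1 else 0 := by
      by_cases hj : j = i <;> simp [partialD, ratToDual_algebraMap, polyToDual, coord, hj]
    by_cases hj : j = i
    · subst hj
      simpa using h1
    · simpa [hj, MvPolynomial.pderiv_X] using h1
  exact DFunLike.congr_fun h a

/-- The ring `W(x, y)` of differential operators with coefficients in `K = ℂ(x, y)`: the
`ℂ`-linear operators on `K` generated under addition and composition by the multiplication
operators `f ↦ a f`, `a ∈ K`, and by `∂/∂x` and `∂/∂y`. -/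
def diffOps : Subalgebra ℂ (Module.End ℂ Rat2) :=
  Algebra.adjoin ℂ (Set.range (Algebra.lmul ℂ Rat2) ∪
    Set.range fun i : Fin 2 => (partialD i : Rat2 →ₗ[ℂ] Rat2))

/-- `W(x, y)` as a type. -/
def W : Type := diffOps

instance instRingW : Ring W := inferInstanceAs (Ring diffOps)

instance instAlgebraW : Algebra ℂ W := inferInstanceAs (Algebra ℂ diffOps)

/-- The action of a differential operator on `K`. -/
def toEnd : W →ₐ[ℂ] Module.End ℂ Rat2 := diffOps.val

/-- The inclusion `K → W(x, y)`, sending `a` to the operator of multiplication by `a`. -/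
def ofRat : Rat2 →ₐ[ℂ] W :=
  (Algebra.lmul ℂ Rat2).codRestrict diffOps fun a => Algebra.subset_adjoin (Or.inl ⟨a, rfl⟩)

/-- `∂/∂x` (for `i = 0`) or `∂/∂y` (for `i = 1`) as an element of `W(x, y)`. -/
def del (i : Fin 2) : W :=
  ⟨(partialD i : Rat2 →ₗ[ℂ] Rat2), Algebra.subset_adjoin (Or.inr ⟨i, rfl⟩)⟩

/-- `W(x, y)` is a `K`-vector space by multiplication from the left. -/
instance instModuleW : Module Rat2 W := Module.compHom W ofRat.toRingHom

theorem rat_smul_def (a : Rat2) (P : W) : a • P = ofRat a * P := rfl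

instance instTowerW : IsScalarTower Rat2 W W :=
  ⟨fun a P Q => by simp only [rat_smul_def, smul_eq_mul, mul_assoc]⟩

/-- The Euler operators `ϑ_x = x ∂/∂x` (for `i = 0`) and `ϑ_y = y ∂/∂y` (for `i = 1`). -/
def theta (i : Fin 2) : W := ofRat (coord i) * del i

/-- The product `(T + a) = (T + a₁) ⋯ (T + aₙ)`, with `(T + a) = 1` for `n = 0`. -/
def addProd {n : ℕ} (T : W) (a : Fin n → ℂ) : W :=
  (List.ofFn fun i => T + algebraMap ℂ W (a i)).prod

/-- The product `(T - a) = (T - a₁) ⋯ (T - aₙ)`, with `(T - a) = 1` for `n = 0`. -/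
def subProd {n : ℕ} (T : W) (a : Fin n → ℂ) : W :=
  (List.ofFn fun i => T - algebraMap ℂ W (a i)).prod

/-- `P₁ = (ϑ_x - α')(ϑ_x + ϑ_y - γ') - x (ϑ_x + α)(ϑ_x + ϑ_y + γ)`. -/
def opP1 {p r p' r' : ℕ} (α : Fin p → ℂ) (γ : Fin r → ℂ) (α' : Fin p' → ℂ) (γ' : Fin r' → ℂ) :
    W :=
  subProd (theta 0) α' * subProd (theta 0 + theta 1) γ' -
    ofRat (coord 0) * addProd (theta 0) α * addProd (theta 0 + theta 1) γ

/-- `P₂ = (ϑ_y - β')(ϑ_x + ϑ_y - γ') - y (ϑ_y + β)(ϑ_x + ϑ_y + γ)`. -/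
def opP2 {q r q' r' : ℕ} (β : Fin q → ℂ) (γ : Fin r → ℂ) (β' : Fin q' → ℂ) (γ' : Fin r' → ℂ) :
    W :=
  subProd (theta 1) β' * subProd (theta 0 + theta 1) γ' -
    ofRat (coord 1) * addProd (theta 1) β * addProd (theta 0 + theta 1) γ

/-- `P₁₂ = x (ϑ_x + α)(ϑ_y - β') - y (ϑ_y + β)(ϑ_x - α')`. -/
def opP12 {p q p' q' : ℕ} (α : Fin p → ℂ) (β : Fin q → ℂ) (α' : Fin p' → ℂ) (β' : Fin q' → ℂ) :
    W :=
  ofRat (coord 0) * addProd (theta 0) α * subProd (theta 1) β' -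
    ofRat (coord 1) * addProd (theta 1) β * subProd (theta 0) α'

/-- The left ideal `W P₁ + W P₂ + W P₁₂` of `W = W(x, y)`. -/
def systemIdeal {p q r p' q' r' : ℕ} (α : Fin p → ℂ) (β : Fin q → ℂ) (γ : Fin r → ℂ)
    (α' : Fin p' → ℂ) (β' : Fin q' → ℂ) (γ' : Fin r' → ℂ) : Submodule W W :=
  Submodule.span W {opP1 α γ α' γ', opP2 β γ β' γ', opP12 α β α' β'}

/-- The `W(x, y)`-module `W / (W P₁ + W P₂ + W P₁₂)`, which is also a `K`-vector space. -/
abbrev SystemModule {p q r p' q' r' : ℕ} (α : Fin p → ℂ) (β : Fin q → ℂ) (γ : Fin r → ℂ)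
    (α' : Fin p' → ℂ) (β' : Fin q' → ℂ) (γ' : Fin r' → ℂ) : Type :=
  W ⧸ systemIdeal α β γ α' β' γ'

/-- The level `L = r - r'`. -/
def level (r r' : ℕ) : ℤ := (r : ℤ) - (r' : ℤ)

/-- The number `R`: `(p' q' r - p q r') / L` if `L ≠ 0` and `p q + q r + r p` if `L = 0`, where
`L = r - r'`. -/
def rankNumber (p q r p' q' r' : ℕ) : ℚ :=
  if level r r' = 0 then (p * q + q * r + r * p : ℚ)
  else ((p' * q' * r : ℚ) - p * q * r') / (level r r' : ℚ)

end

end HGSystem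

/-! Filter `W` by order. The symbols of `ϑ_x`, `ϑ_y` generate a polynomial ring over `K` in two
variables `X 0`, `X 1`, and the parameters affect only lower-order terms, so the rank can be read
off from principal symbols provided the leading terms of the left ideal are under control.

The symbols of the three operators are the signed maximal minors of a `3 × 2` matrix with columns
`symbolU` and `symbolV`. A common prime factor would give a common zero `(s, t) ≠ (0, 0)` over an
extension field; normalised to `s + t = 1` this would make `s ^ L = x` and `t ^ L = y`,
contradicting the algebraic independence of `x` and `y` (`eq_zero_of_symbols_eq_zero`). Hence, as in
the Hilbert–Burch theorem, the two columns freely generate the syzygies of the symbols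
(`exists_syzygy_eq`, `symbol_columns_independent`).

Both columns lift to exact relations between the operators (`liftedSyzygies`). Every cancellation of
leading terms in `∑ Aᵢ Pᵢ` can therefore be removed (`exists_lower`), and the part of the ideal of
order less than `n` has a resolution by spaces of operators of bounded order. With `N(k) =
k(k+1)/2`, the rank is, for large `n`, `N(n) - N(n-p-r) - N(n-q-r) - N(n-p-q') + N(n-p-r-q') +
N(n-p-q-r) = pq + pr + rq'` (`finrank_quotient`), which is the stated number. -/

namespace HGSystem

open MvPolynomial

/-! ### Syzygies of the minors of a `3 × 2` matrix over a factorial domain. -/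

section Determinantal

variable {R : Type*} [CommRing R] [IsDomain R] [UniqueFactorizationMonoid R]

/-- A vector parallel to a vector whose entries have no common prime factor is a multiple of it. -/
theorem exists_eq_mul_of_parallel (m n : Fin 3 → R)
    (hm : ∀ π, Prime π → ∃ i, ¬ π ∣ m i) (hne : m ≠ 0)
    (h : ∀ i j, n i * m j = n j * m i) : ∃ l, ∀ i, n i = l * m i := by
  classical
  let _ : StrongNormalizationMonoid R := UniqueFactorizationMonoid.strongNormalizationMonoid
  let _ : StrongNormalizedGCDMonoid R :=
    UniqueFactorizationMonoid.toStrongNormalizedGCDMonoid R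
  obtain ⟨i, hi⟩ := Function.ne_iff.mp hne
  rw [Pi.zero_apply] at hi
  have hu : IsUnit (Finset.univ.gcd m) := by
    by_contra hu
    have h0 : Finset.univ.gcd m ≠ 0 := fun h0 =>
      hi (Finset.gcd_eq_zero_iff.mp h0 i (Finset.mem_univ i))
    obtain ⟨π, hπ, hd⟩ := WfDvdMonoid.exists_irreducible_factor hu h0
    obtain ⟨j, hj⟩ := hm π hπ.prime
    exact hj (hd.trans (Finset.gcd_dvd (Finset.mem_univ j)))
  -- Parallelism makes `m i` divide every `n i * m j`, hence `n i` times the gcd of `m`, which is a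
  -- unit.
  have hd : m i ∣ Finset.univ.gcd fun j => n i * m j :=
    Finset.dvd_gcd fun j _ => ⟨n j, by rw [h i j, mul_comm]⟩
  rw [Finset.gcd_mul_left, hu.dvd_mul_right, dvd_normalize_iff] at hd
  obtain ⟨l, hl⟩ := hd
  refine ⟨l, fun j => mul_right_cancel₀ hi ?_⟩
  rw [← h i j, hl]
  ring

/-- The syzygies of the maximal minors of a `3 × 2` matrix are generated by its columns, if the
minors have no common prime factor. -/
theorem exists_syzygy_eq (u v w m : Fin 3 → R)
    (h0 : m 0 = u 2 * v 1 - u 1 * v 2) (h1 : m 1 = u 0 * v 2 - u 2 * v 0)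
    (h2 : m 2 = u 1 * v 0 - u 0 * v 1)
    (hm : ∀ π, Prime π → ∃ i, ¬ π ∣ m i) (hne : m ≠ 0)
    (hw : w 0 * m 0 + w 1 * m 1 + w 2 * m 2 = 0) :
    ∃ l k, ∀ i, w i = l * u i + k * v i := by
  -- Both `w` and `a` are orthogonal to `m`, so the cross product `a × w` is parallel to `m`.
  have parallel (a : Fin 3 → R) (ha : a 0 * m 0 + a 1 * m 1 + a 2 * m 2 = 0) :
      ∃ l, w 2 * a 1 - w 1 * a 2 = l * m 0 ∧ w 0 * a 2 - w 2 * a 0 = l * m 1 ∧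
        w 1 * a 0 - w 0 * a 1 = l * m 2 := by
    obtain ⟨l, hl⟩ := exists_eq_mul_of_parallel m
      ![w 2 * a 1 - w 1 * a 2, w 0 * a 2 - w 2 * a 0, w 1 * a 0 - w 0 * a 1] hm hne (by
        intro i j
        fin_cases i <;> fin_cases j <;> simp <;> first
          | linear_combination w 2 * ha - a 2 * hw
          | linear_combination -w 2 * ha + a 2 * hw
          | linear_combination w 1 * ha - a 1 * hw
          | linear_combination -w 1 * ha + a 1 * hw
          | linear_combination w 0 * ha - a 0 * hw
          | linear_combination -w 0 * ha + a 0 * hw)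
    exact ⟨l, by simpa using hl 0, by simpa using hl 1, by simpa using hl 2⟩
  -- As `m = v × u`, the relation `v × w = l m` makes `l` the coefficient of `u`, and `u × w = k m =
  -- -k (u × v)` makes `-k` that of `v`.
  obtain ⟨l, l0, l1, l2⟩ := parallel v (by rw [h0, h1, h2]; ring)
  obtain ⟨k, k0, k1, k2⟩ := parallel u (by rw [h0, h1, h2]; ring)
  refine ⟨l, -k, fun i => ?_⟩
  obtain ⟨j, hj⟩ := Function.ne_iff.mp hne
  have hv (a b : Fin 3) :
      (w a - (l * u a + -k * v a)) * v b = (w b - (l * u b + -k * v b)) * v a := by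
    rw [h0] at l0
    rw [h1] at l1
    rw [h2] at l2
    fin_cases a <;> fin_cases b <;> simp <;> first
      | ring1
      | linear_combination l0
      | linear_combination -l0
      | linear_combination l1
      | linear_combination -l1
      | linear_combination l2
      | linear_combination -l2
  have hu (a b : Fin 3) :
      (w a - (l * u a + -k * v a)) * u b = (w b - (l * u b + -k * v b)) * u a := by
    rw [h0] at k0
    rw [h1] at k1
    rw [h2] at k2
    fin_cases a <;> fin_cases b <;> simp <;> first
      | ring1
      | linear_combination k0
      | linear_combination -k0
      | linear_combination k1
      | linear_combination -k1
      | linear_combination k2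
      | linear_combination -k2
  -- The difference has zero cross product with both columns, so it is annihilated by every minor,
  -- and one minor is nonzero.
  have minor (a b : Fin 3) : (w i - (l * u i + -k * v i)) * (u a * v b - u b * v a) = 0 := by
    linear_combination u a * hv i b - u b * hv i a + v i * hu b a
  refine sub_eq_zero.mp ((mul_eq_zero.mp ?_).resolve_right hj)
  fin_cases j
  · exact h0 ▸ minor 2 1
  · exact h1 ▸ minor 0 2
  · exact h2 ▸ minor 1 0

end Determinantal

/-! ### Common zeros of the symbols. -/

section Point

variable {k F : Type*} [Field k] [Field F] [Algebra k F] {x y : F}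

theorem _root_.AlgebraicIndependent.not_isAlgebraic_adjoin (h : AlgebraicIndependent k ![x, y]) :
    ¬ IsAlgebraic (Algebra.adjoin k {x}) y := by
  have h1 := h.transcendental_adjoin (s := {0}) (i := 1) (by simp)
  rwa [Set.image_singleton] at h1

theorem _root_.AlgebraicIndependent.swap (h : AlgebraicIndependent k ![x, y]) :
    AlgebraicIndependent k ![y, x] := by
  have h1 := h.comp ![1, 0] (by decide)
  convert h1 using 1
  ext i
  fin_cases i <;> rfl

theorem _root_.AlgebraicIndependent.not_isAlgebraic (h : AlgebraicIndependent k ![x, y]) :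
    ¬ IsAlgebraic k y :=
  h.transcendental 1

/-- On the line `s + t = 1` the coordinates cannot both be `L`-th roots of algebraically
independent elements. -/
theorem _root_.AlgebraicIndependent.add_ne_one_of_pow_eq (h : AlgebraicIndependent k ![x, y])
    {s t : F} {n : ℕ} (hn : n ≠ 0) (hs : s ^ n = x) (ht : t ^ n = y) : s + t ≠ 1 := by
  intro hst
  have hx : IsAlgebraic (Algebra.adjoin k {x}) x :=
    isAlgebraic_algebraMap (⟨x, Algebra.subset_adjoin rfl⟩ : Algebra.adjoin k {x})
  have hsa : IsAlgebraic (Algebra.adjoin k {x}) s :=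
    IsAlgebraic.of_pow (Nat.pos_of_ne_zero hn) (hs ▸ hx)
  apply h.not_isAlgebraic_adjoin
  rw [← ht, eq_sub_of_add_eq' hst]
  exact (isAlgebraic_one.sub hsa).pow n

/-- The case of negative `L`, with `n = -L`. -/
theorem _root_.AlgebraicIndependent.add_ne_one_of_pow_eq_inv (h : AlgebraicIndependent k ![x, y])
    {s t : F} {n : ℕ} (hn : n ≠ 0) (hs : s ^ n = x⁻¹) (ht : t ^ n = y⁻¹) : s + t ≠ 1 := by
  intro hst
  have hx : IsAlgebraic (Algebra.adjoin k {x}) x :=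
    isAlgebraic_algebraMap (⟨x, Algebra.subset_adjoin rfl⟩ : Algebra.adjoin k {x})
  have hsa : IsAlgebraic (Algebra.adjoin k {x}) s :=
    IsAlgebraic.of_pow (Nat.pos_of_ne_zero hn) (hs ▸ hx.inv)
  apply h.not_isAlgebraic_adjoin
  rw [← inv_inv y, ← ht, eq_sub_of_add_eq' hst]
  exact ((isAlgebraic_one.sub hsa).pow n).inv

/-- The principal symbols of the three operators have no common zero on the projective line. -/
theorem eq_zero_of_symbols_eq_zero (h : AlgebraicIndependent k ![x, y])
    {p q r p' q' r' : ℕ} (hx : p + r = p' + r') (hy : q + r = q' + r') {s t : F}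
    (h1 : s ^ p' * (s + t) ^ r' = x * s ^ p * (s + t) ^ r)
    (h2 : t ^ q' * (s + t) ^ r' = y * t ^ q * (s + t) ^ r)
    (h3 : x * s ^ p * t ^ q' = y * t ^ q * s ^ p') : s = 0 ∧ t = 0 := by
  have hx1 : x ≠ 1 := by
    rintro rfl
    exact h.swap.not_isAlgebraic isAlgebraic_one
  have hy1 : y ≠ 1 := by
    rintro rfl
    exact h.not_isAlgebraic isAlgebraic_one
  have hx0 : x ≠ 0 := by
    rintro rfl
    exact h.swap.not_isAlgebraic isAlgebraic_zero
  have hy0 : y ≠ 0 := by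
    rintro rfl
    exact h.not_isAlgebraic isAlgebraic_zero
  -- On `s + t = 0` the first two equations may be void and the third only gives `x = ± y`; squaring
  -- disposes of the sign.
  have hxy : x ^ 2 ≠ y ^ 2 := by
    intro he
    apply h.not_isAlgebraic_adjoin
    refine IsAlgebraic.of_pow two_pos (he ▸ IsAlgebraic.pow ?_ 2)
    exact isAlgebraic_algebraMap (⟨x, Algebra.subset_adjoin rfl⟩ : Algebra.adjoin k {x})
  by_cases hs : s = 0
  · refine ⟨hs, by_contra fun ht => hy1 ?_⟩
    subst hs
    rw [zero_add, ← pow_add, mul_assoc, ← pow_add, ← hy] at h2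
    exact (mul_eq_right₀ (pow_ne_zero _ ht)).mp h2.symm
  exfalso
  by_cases ht : t = 0
  · subst ht
    rw [add_zero, ← pow_add, mul_assoc, ← pow_add, ← hx] at h1
    exact hx1 ((mul_eq_right₀ (pow_ne_zero _ hs)).mp h1.symm)
  by_cases hz : s + t = 0
  · apply hxy
    obtain rfl : t = -s := eq_neg_of_add_eq_zero_right hz
    have hd : p + q' = p' + q := by omega
    have h4 := congrArg (· ^ 2) h3
    simp only [mul_pow, ← pow_mul, mul_comm _ 2] at h4
    simp only [pow_mul, neg_sq] at h4
    rw [mul_assoc, mul_assoc, ← pow_add, ← pow_add, hd, add_comm q] at h4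
    exact mul_right_cancel₀ (pow_ne_zero _ (pow_ne_zero _ hs)) h4
  -- After this normalisation the first two equations say that the `L`-th powers of the coordinates
  -- are `x` and `y`; for `L = 0` the first already gives `x = 1`.
  have hst : s / (s + t) + t / (s + t) = 1 := by rw [← add_div, div_self hz]
  rcases lt_trichotomy r r' with hr | rfl | hr
  · obtain ⟨n, rfl⟩ := Nat.exists_eq_add_of_lt hr
    obtain rfl : p = p' + (n + 1) := by omega
    obtain rfl : q = q' + (n + 1) := by omega
    refine h.add_ne_one_of_pow_eq_inv (n := n + 1) n.succ_ne_zero ?_ ?_ hst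
    · rw [div_pow, div_eq_iff (pow_ne_zero _ hz), inv_mul_eq_div, eq_div_iff hx0]
      apply mul_left_cancel₀ (mul_ne_zero (pow_ne_zero p' hs) (pow_ne_zero r hz))
      linear_combination -h1
    · rw [div_pow, div_eq_iff (pow_ne_zero _ hz), inv_mul_eq_div, eq_div_iff hy0]
      apply mul_left_cancel₀ (mul_ne_zero (pow_ne_zero q' ht) (pow_ne_zero r hz))
      linear_combination -h2
  · obtain rfl : p = p' := by omega
    apply hx1
    apply mul_right_cancel₀ (mul_ne_zero (pow_ne_zero p hs) (pow_ne_zero r hz))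
    linear_combination -h1
  · obtain ⟨n, rfl⟩ := Nat.exists_eq_add_of_lt hr
    obtain rfl : p' = p + (n + 1) := by omega
    obtain rfl : q' = q + (n + 1) := by omega
    refine h.add_ne_one_of_pow_eq (n := n + 1) n.succ_ne_zero ?_ ?_ hst
    · rw [div_pow, div_eq_iff (pow_ne_zero _ hz)]
      apply mul_left_cancel₀ (mul_ne_zero (pow_ne_zero p hs) (pow_ne_zero r' hz))
      linear_combination h1
    · rw [div_pow, div_eq_iff (pow_ne_zero _ hz)]
      apply mul_left_cancel₀ (mul_ne_zero (pow_ne_zero q ht) (pow_ne_zero r' hz))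
      linear_combination h2

end Point

/-! ### Homogeneous syzygies of the principal symbols. -/

noncomputable section Symbols

variable {K : Type*} [Field K]

/-- The homogeneous polynomials of degree `k ∈ ℤ` in two variables. -/
abbrev homog (K : Type*) [Field K] (k : ℤ) : Submodule K (MvPolynomial (Fin 2) K) :=
  weightedHomogeneousSubmodule K (fun _ : Fin 2 => (1 : ℤ)) k

theorem X_mem_homog (i : Fin 2) : X i ∈ homog K 1 :=
  isWeightedHomogeneous_X K (fun _ => (1 : ℤ)) i

theorem C_mem_homog (a : K) : C a ∈ homog K 0 :=
  isWeightedHomogeneous_C (fun _ => (1 : ℤ)) a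

theorem pow_mem_homog {f : MvPolynomial (Fin 2) K} (hf : f ∈ homog K 1) (n : ℕ) :
    f ^ n ∈ homog K n := by
  have h : IsWeightedHomogeneous (fun _ => (1 : ℤ)) (f ^ n) (n • (1 : ℤ)) :=
    IsWeightedHomogeneous.pow hf n
  simpa using h

theorem mul_mem_homog {f g : MvPolynomial (Fin 2) K} {a b : ℤ} (hf : f ∈ homog K a)
    (hg : g ∈ homog K b) : f * g ∈ homog K (a + b) :=
  IsWeightedHomogeneous.mul hf hg

/-- Used to replace the coefficients of a syzygy by homogeneous components. -/
theorem weightedHomogeneousComponent_mul_of_mem (f : MvPolynomial (Fin 2) K)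
    {g : MvPolynomial (Fin 2) K} {a b : ℤ} (hg : g ∈ homog K b) :
    weightedHomogeneousComponent (fun _ : Fin 2 => (1 : ℤ)) (a + b) (f * g) =
      weightedHomogeneousComponent (fun _ : Fin 2 => (1 : ℤ)) a f * g := by
  classical
  ext d
  rw [coeff_weightedHomogeneousComponent, coeff_mul, coeff_mul]
  trans ∑ e ∈ Finset.HasAntidiagonal.antidiagonal d, if Finsupp.weight (fun _ => (1 : ℤ)) d = a + b then
    coeff e.1 f * coeff e.2 g else 0
  · split_ifs <;> simp
  refine Finset.sum_congr rfl fun e he => ?_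
  rw [coeff_weightedHomogeneousComponent, ← Finset.HasAntidiagonal.mem_antidiagonal.mp he, map_add]
  by_cases h0 : coeff e.2 g = 0
  · simp [h0]
  · rw [hg h0]
    simp [ite_mul]

/-- The principal symbols of `P₁`, `P₂` and `P₁₂`. -/
def symbolP (x y : K) (p q r p' q' r' : ℕ) : Fin 3 → MvPolynomial (Fin 2) K :=
  ![X 0 ^ p' * (X 0 + X 1) ^ r' - C x * X 0 ^ p * (X 0 + X 1) ^ r,
    X 1 ^ q' * (X 0 + X 1) ^ r' - C y * X 1 ^ q * (X 0 + X 1) ^ r,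
    C x * X 0 ^ p * X 1 ^ q' - C y * X 1 ^ q * X 0 ^ p']

/-- The first syzygy of the principal symbols. -/
def symbolU (p' q' r : ℕ) : Fin 3 → MvPolynomial (Fin 2) K :=
  ![X 1 ^ q', -X 0 ^ p', (X 0 + X 1) ^ r]

/-- The second syzygy of the principal symbols. -/
def symbolV (x y : K) (p q r' : ℕ) : Fin 3 → MvPolynomial (Fin 2) K :=
  ![C y * X 1 ^ q, -(C x * X 0 ^ p), (X 0 + X 1) ^ r']

variable {k : Type*} [Field k] [Algebra k K] {x y : K}

/-- If `π` divided all three, the classes of `X 0`, `X 1` in the fraction field of the quotient by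
`π` would be a common zero. Both classes then vanish, so `π` divides two non-associated primes. -/
theorem exists_not_dvd_symbolP (h : AlgebraicIndependent k ![x, y]) {p q r p' q' r' : ℕ}
    (hx : p + r = p' + r') (hy : q + r = q' + r') (π : MvPolynomial (Fin 2) K) (hπ : Prime π) :
    ∃ i, ¬ π ∣ symbolP x y p q r p' q' r' i := by
  by_contra! hd
  let I : Ideal (MvPolynomial (Fin 2) K) := Ideal.span {π}
  have hI : I.IsPrime := (Ideal.span_singleton_prime hπ.ne_zero).mpr hπ
  let F := FractionRing (MvPolynomial (Fin 2) K ⧸ I)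
  let φ : MvPolynomial (Fin 2) K →+* F :=
    (algebraMap (MvPolynomial (Fin 2) K ⧸ I) F).comp (Ideal.Quotient.mk I)
  have hφ (f : MvPolynomial (Fin 2) K) : φ f = 0 ↔ π ∣ f := by
    rw [← Ideal.mem_span_singleton, ← Ideal.Quotient.eq_zero_iff_mem]
    exact map_eq_zero_iff _ (IsFractionRing.injective (MvPolynomial (Fin 2) K ⧸ I) F)
  have hF : AlgebraicIndependent k ![φ (C x), φ (C y)] := by
    have h1 := h.map' (f := IsScalarTower.toAlgHom k K F) (algebraMap K F).injective
    convert h1 using 1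
    ext i
    fin_cases i <;> rfl
  have e (i : Fin 3) := (hφ _).mpr (hd i)
  have e0 := e 0
  have e1 := e 1
  have e2 := e 2
  simp only [symbolP, Matrix.cons_val, map_sub, map_mul, map_pow, map_add, sub_eq_zero]
    at e0 e1 e2
  obtain ⟨hs, ht⟩ := eq_zero_of_symbols_eq_zero hF hx hy e0 e1 e2
  rw [hφ] at hs ht
  have := hπ.irreducible.dvd_symm (X_prime (R := K) (i := (0 : Fin 2))).irreducible hs
  exact absurd (X_dvd_X.mp (this.trans ht)) (by decide)

theorem symbolP_ne_zero (h : AlgebraicIndependent k ![x, y]) {p q r p' q' r' : ℕ}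
    (hx : p + r = p' + r') (hy : q + r = q' + r') : symbolP x y p q r p' q' r' ≠ 0 := by
  intro h0
  obtain ⟨i, hi⟩ := exists_not_dvd_symbolP h hx hy (X 0) X_prime
  exact hi (by simp [h0])

theorem symbolU_mem (p' q' r : ℕ) : symbolU (K := K) p' q' r 0 ∈ homog K q' ∧
    symbolU (K := K) p' q' r 1 ∈ homog K p' ∧ symbolU (K := K) p' q' r 2 ∈ homog K r :=
  ⟨pow_mem_homog (X_mem_homog 1) q', neg_mem (pow_mem_homog (X_mem_homog 0) p'),
    pow_mem_homog (add_mem (X_mem_homog 0) (X_mem_homog 1)) r⟩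

theorem symbolV_mem (x y : K) (p q r' : ℕ) : symbolV x y p q r' 0 ∈ homog K q ∧
    symbolV x y p q r' 1 ∈ homog K p ∧ symbolV x y p q r' 2 ∈ homog K r' := by
  refine ⟨?_, neg_mem ?_, pow_mem_homog (add_mem (X_mem_homog 0) (X_mem_homog 1)) r'⟩
  · simpa [symbolV] using mul_mem_homog (C_mem_homog y) (pow_mem_homog (X_mem_homog 1) q)
  · simpa using mul_mem_homog (C_mem_homog x) (pow_mem_homog (X_mem_homog 0) p)

/-- The homogeneous syzygies of the principal symbols. -/
theorem exists_symbol_syzygy (h : AlgebraicIndependent k ![x, y]) {p q r p' q' r' : ℕ}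
    (hx : p + r = p' + r') (hy : q + r = q' + r') (w : Fin 3 → MvPolynomial (Fin 2) K) (n : ℤ)
    (w0 : w 0 ∈ homog K (n - (p + r))) (w1 : w 1 ∈ homog K (n - (q + r)))
    (w2 : w 2 ∈ homog K (n - (p + q')))
    (hw : w 0 * symbolP x y p q r p' q' r' 0 + w 1 * symbolP x y p q r p' q' r' 1 +
      w 2 * symbolP x y p q r p' q' r' 2 = 0) :
    ∃ a ∈ homog K (n - (p + r + q')), ∃ b ∈ homog K (n - (p + q + r)),
      ∀ i, w i = a * symbolU p' q' r i + b * symbolV x y p q r' i := by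
  obtain ⟨a, b, hab⟩ := exists_syzygy_eq (symbolU p' q' r) (symbolV x y p q r') w
    (symbolP x y p q r p' q' r')
    (by simp [symbolP, symbolU, symbolV]; ring) (by simp [symbolP, symbolU, symbolV]; ring)
    (by simp [symbolP, symbolU, symbolV]; ring) (exists_not_dvd_symbolP h hx hy)
    (symbolP_ne_zero h hx hy) hw
  obtain ⟨u0, u1, u2⟩ := symbolU_mem (K := K) p' q' r
  obtain ⟨v0, v1, v2⟩ := symbolV_mem x y p q r'
  have key {f u v : MvPolynomial (Fin 2) K} {i j l : ℤ} (hf : f ∈ homog K l)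
      (hu : u ∈ homog K i) (hv : v ∈ homog K j) (hi : n - (p + r + q') + i = l)
      (hj : n - (p + q + r) + j = l) (he : f = a * u + b * v) :
      f = weightedHomogeneousComponent (fun _ : Fin 2 => (1 : ℤ)) (n - (p + r + q')) a * u +
        weightedHomogeneousComponent (fun _ : Fin 2 => (1 : ℤ)) (n - (p + q + r)) b * v := by
    rw [← weightedHomogeneousComponent_mul_of_mem a hu,
      ← weightedHomogeneousComponent_mul_of_mem b hv, hi, hj, ← map_add, ← he,
      weightedHomogeneousComponent_of_mem hf, if_pos rfl]
  refine ⟨_, weightedHomogeneousComponent_mem _ a _, _, weightedHomogeneousComponent_mem _ b _,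
    fun i => ?_⟩
  fin_cases i
  · exact key w0 u0 v0 (by ring) (by ring) (hab 0)
  · exact key w1 u1 v1 (by omega) (by ring) (hab 1)
  · exact key w2 u2 v2 (by ring) (by omega) (hab 2)

/-- Cramer's rule: eliminating one unknown from two of the equations multiplies the other by a
maximal minor, and some minor is nonzero. -/
theorem symbol_columns_independent (h : AlgebraicIndependent k ![x, y]) {p q r p' q' r' : ℕ}
    (hx : p + r = p' + r') (hy : q + r = q' + r') (a b : MvPolynomial (Fin 2) K)
    (hab : ∀ i, a * symbolU p' q' r i + b * symbolV x y p q r' i = 0) : a = 0 ∧ b = 0 := by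
  obtain ⟨i, hi⟩ := Function.ne_iff.mp (symbolP_ne_zero h hx hy)
  have h0 := hab 0
  have h1 := hab 1
  have h2 := hab 2
  simp only [symbolU, symbolV, Matrix.cons_val] at h0 h1 h2
  refine ⟨(mul_eq_zero.mp ?_).resolve_right hi, (mul_eq_zero.mp ?_).resolve_right hi⟩
  · fin_cases i <;> simp only [symbolP, Fin.zero_eta, Fin.mk_one, Fin.reduceFinMk, Matrix.cons_val]
    · linear_combination -(C x * X 0 ^ p) * h2 - (X 0 + X 1) ^ r' * h1
    · linear_combination (X 0 + X 1) ^ r' * h0 - C y * X 1 ^ q * h2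
    · linear_combination C y * X 1 ^ q * h1 + C x * X 0 ^ p * h0
  · fin_cases i <;> simp only [symbolP, Fin.zero_eta, Fin.mk_one, Fin.reduceFinMk, Matrix.cons_val]
    · linear_combination X 0 ^ p' * h2 + (X 0 + X 1) ^ r * h1
    · linear_combination X 1 ^ q' * h2 - (X 0 + X 1) ^ r * h0
    · linear_combination -X 1 ^ q' * h1 - X 0 ^ p' * h0

end Symbols

/-! ### Normal forms of operators in `ϑ_x`, `ϑ_y`. -/

noncomputable section

theorem algebraicIndependent_coord : AlgebraicIndependent ℂ ![coord 0, coord 1] := by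
  have h : AlgebraicIndependent ℂ (coord : Fin 2 → Rat2) :=
    (MvPolynomial.algebraicIndependent_X (Fin 2) ℂ).map'
      (f := IsScalarTower.toAlgHom ℂ Poly2 Rat2) (IsFractionRing.injective Poly2 Rat2)
  convert h using 1
  ext i
  fin_cases i <;> rfl

theorem coord_ne_zero (i : Fin 2) : coord i ≠ 0 :=
  (map_ne_zero_iff _ (IsFractionRing.injective Poly2 Rat2)).mpr (X_ne_zero i)

theorem partialD_coord (i j : Fin 2) : partialD i (coord j) = if j = i then 1 else 0 := by
  rw [coord, partialD_algebraMap, pderiv_X, Pi.single_apply]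
  split_ifs <;> simp

/-- A derivation of `ℂ(x, y)` that vanishes on `x` and `y` is zero. -/
theorem derivation_eq_zero (D : Derivation ℂ Rat2 Rat2) (h : ∀ i, D (coord i) = 0) : D = 0 := by
  have hp : D.compAlgebraMap Poly2 = 0 := by
    apply MvPolynomial.derivation_ext
    intro i
    exact h i
  have hp' (a : Poly2) : D (algebraMap Poly2 Rat2 a) = 0 := DFunLike.congr_fun hp a
  ext f
  obtain ⟨⟨a, b⟩, hab⟩ := IsLocalization.surj (nonZeroDivisors Poly2) f
  have hb : algebraMap Poly2 Rat2 b ≠ 0 :=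
    IsLocalization.to_map_ne_zero_of_mem_nonZeroDivisors Rat2 le_rfl b.2
  have h1 := congrArg D hab
  simpa [hp', hb] using h1

theorem partialD_comm (i j : Fin 2) (f : Rat2) :
    partialD i (partialD j f) = partialD j (partialD i f) := by
  have h : ⁅partialD i, partialD j⁆ = 0 := by
    refine derivation_eq_zero _ fun l => ?_
    rw [Derivation.commutator_apply, partialD_coord, partialD_coord]
    split_ifs <;> simp
  have h1 := DFunLike.congr_fun h f
  rwa [Derivation.commutator_apply, Derivation.zero_apply, sub_eq_zero] at h1

theorem W_ext {P Q : W} (h : ∀ f, toEnd P f = toEnd Q f) : P = Q :=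
  Subtype.ext (LinearMap.ext h)

@[simp] theorem toEnd_ofRat (a f : Rat2) : toEnd (ofRat a) f = a * f := rfl

@[simp] theorem toEnd_theta (i : Fin 2) (f : Rat2) :
    toEnd (theta i) f = coord i * partialD i f := rfl

theorem theta_mul_ofRat (i : Fin 2) (a : Rat2) :
    theta i * ofRat a = ofRat a * theta i + ofRat (coord i * partialD i a) := by
  refine W_ext fun f => ?_
  simp
  ring

theorem commute_theta : Commute (theta 0) (theta 1) := by
  refine W_ext fun f => ?_
  simp [partialD_coord, partialD_comm 0 1]
  ring

theorem commute_theta_theta (i j : Fin 2) : Commute (theta i) (theta j) := by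
  fin_cases i <;> fin_cases j
  exacts [Commute.refl _, commute_theta, commute_theta.symm, Commute.refl _]

theorem theta_mul_coord (i j : Fin 2) :
    theta i * ofRat (coord j) = ofRat (coord j) * (theta i + if j = i then 1 else 0) := by
  rw [theta_mul_ofRat, partialD_coord, mul_add]
  split_ifs with h <;> simp [h]

theorem toEnd_theta_pow (i : Fin 2) (n : ℕ) (f c : Rat2) (hc : partialD i c = 0)
    (h : coord i * partialD i f = c * f) : toEnd (theta i ^ n) f = c ^ n * f := by
  induction n with
  | zero => simp
  | succ n ih =>
    rw [pow_succ', map_mul, Module.End.mul_apply, ih, toEnd_theta, Derivation.leibniz,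
      Derivation.leibniz_pow, hc]
    simp only [smul_eq_mul, mul_zero, add_zero, nsmul_zero]
    linear_combination c ^ n * h

/-- The operators `∑ a_{ij} ϑ_x^i ϑ_y^j`, as the values of a linear map on polynomials. -/
def normalOrder : MvPolynomial (Fin 2) Rat2 →ₗ[Rat2] W :=
  (basisMonomials (Fin 2) Rat2).constr Rat2 fun s => theta 0 ^ s 0 * theta 1 ^ s 1

theorem normalOrder_monomial (s : Fin 2 →₀ ℕ) (a : Rat2) :
    normalOrder (monomial s a) = ofRat a * (theta 0 ^ s 0 * theta 1 ^ s 1) := by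
  have h : monomial s a = a • basisMonomials (Fin 2) Rat2 s := by
    simp [smul_monomial]
  rw [h, map_smul, normalOrder, Module.Basis.constr_basis, rat_smul_def]

/-- The monomials `x ^ s y ^ t` are joint eigenfunctions of `ϑ_x`, `ϑ_y` with eigenvalues `s`, `t`,
and the coefficients stand on the left. -/
theorem toEnd_normalOrder (g : MvPolynomial (Fin 2) Rat2) (s t : ℕ) :
    toEnd (normalOrder g) (coord 0 ^ s * coord 1 ^ t) =
      eval ![(s : Rat2), (t : Rat2)] g * (coord 0 ^ s * coord 1 ^ t) := by
  have hs (i : Fin 2) (n : ℕ) : coord i * ((n : Rat2) * coord i ^ (n - 1)) = n * coord i ^ n := by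
    cases n with
    | zero => simp
    | succ n => simp; ring
  induction g using MvPolynomial.induction_on' with
  | monomial d a =>
    rw [normalOrder_monomial, map_mul toEnd, map_mul toEnd, Module.End.mul_apply,
      Module.End.mul_apply, toEnd_theta_pow 1 _ _ (t : Rat2) (by simp)]
    · rw [toEnd_theta_pow 0 _ _ (s : Rat2) (by simp)]
      · simp [eval_monomial, Finsupp.prod_fintype]
        ring
      · have := hs 0 s
        simp [Derivation.leibniz_pow, partialD_coord]
        linear_combination (t ^ d 1 * coord 1 ^ t) * this
    · have := hs 1 t
      simp [Derivation.leibniz_pow, partialD_coord]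
      linear_combination (coord 0 ^ s) * this
  | add g h hg hh => simp [hg, hh, add_mul]

/-- A polynomial vanishing on `ℕ × ℕ` is zero. This makes order and symbol well defined. -/
theorem normalOrder_injective : Function.Injective normalOrder := by
  rw [injective_iff_map_eq_zero]
  intro g hg
  refine MvPolynomial.funext_set (fun _ => Set.range ((↑) : ℕ → Rat2))
    (fun _ => Set.infinite_range_of_injective Nat.cast_injective) fun v hv => ?_
  obtain ⟨s, hs⟩ := hv 0 trivial
  obtain ⟨t, ht⟩ := hv 1 trivial
  obtain rfl : v = ![(s : Rat2), (t : Rat2)] := by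
    ext i
    fin_cases i
    exacts [hs.symm, ht.symm]
  have h := toEnd_normalOrder g s t
  rw [hg, map_zero, LinearMap.zero_apply, eq_comm, mul_eq_zero] at h
  rw [map_zero]
  exact h.resolve_right
    (mul_ne_zero (pow_ne_zero _ (coord_ne_zero 0)) (pow_ne_zero _ (coord_ne_zero 1)))

end

/-! ### The order filtration and principal symbols. -/

noncomputable section

/-- The total degree of a monomial, as an integer. -/
abbrev deg (s : Fin 2 →₀ ℕ) : ℤ := Finsupp.weight (fun _ : Fin 2 => (1 : ℤ)) s

theorem deg_eq (s : Fin 2 →₀ ℕ) : deg s = s 0 + s 1 := by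
  simp [deg, Finsupp.weight_apply, Finsupp.sum_fintype]

/-- The polynomials of degree less than `k`. -/
def degLT (k : ℤ) : Submodule Rat2 (MvPolynomial (Fin 2) Rat2) :=
  restrictSupport Rat2 {s | deg s < k}

theorem mem_degLT {k : ℤ} {f : MvPolynomial (Fin 2) Rat2} :
    f ∈ degLT k ↔ ∀ s ∈ f.support, deg s < k := Iff.rfl

theorem degLT_mono {a b : ℤ} (h : a ≤ b) : degLT a ≤ degLT b :=
  restrictSupport_mono _ fun _ hs => lt_of_lt_of_le hs h

theorem mul_mem_degLT {f g : MvPolynomial (Fin 2) Rat2} {a b : ℤ} (hf : f ∈ degLT a)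
    (hg : g ∈ degLT b) : f * g ∈ degLT (a + b - 1) := by
  classical
  intro s hs
  obtain ⟨t, ht, u, hu, rfl⟩ := Finset.mem_add.mp (support_mul f g hs)
  have h1 := mem_degLT.mp hf t ht
  have h2 := mem_degLT.mp hg u hu
  change deg (t + u) < _
  rw [show deg (t + u) = deg t + deg u from map_add _ t u]
  omega

theorem homog_le_degLT {k : ℤ} {f : MvPolynomial (Fin 2) Rat2} (hf : f ∈ homog Rat2 k) :
    f ∈ degLT (k + 1) :=
  mem_degLT.mpr fun _ hs => (hf (mem_support_iff.mp hs)).trans_lt (lt_add_one k)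

theorem eq_zero_of_mem_homog_of_mem_degLT {k : ℤ} {f : MvPolynomial (Fin 2) Rat2}
    (hf : f ∈ homog Rat2 k) (h : f ∈ degLT k) : f = 0 := by
  rw [← support_eq_empty]
  refine Finset.eq_empty_of_forall_notMem fun s hs => ?_
  exact (mem_degLT.mp h s hs).ne (hf (mem_support_iff.mp hs))

theorem sub_weightedHomogeneousComponent_mem {k : ℤ} {f : MvPolynomial (Fin 2) Rat2}
    (hf : f ∈ degLT (k + 1)) :
    f - weightedHomogeneousComponent (fun _ : Fin 2 => (1 : ℤ)) k f ∈ degLT k := by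
  refine mem_degLT.mpr fun s hs => ?_
  rw [mem_support_iff, coeff_sub, coeff_weightedHomogeneousComponent] at hs
  split_ifs at hs with h
  · simp at hs
  · rw [sub_zero] at hs
    have := mem_degLT.mp hf s (mem_support_iff.mpr hs)
    change deg s ≠ k at h
    omega

/-- The operators of order less than `k`. -/
def filt (k : ℤ) : Submodule Rat2 W := (degLT k).map normalOrder

theorem filt_mono {a b : ℤ} (h : a ≤ b) : filt a ≤ filt b := Submodule.map_mono (degLT_mono h)

theorem filt_of_nonpos {k : ℤ} (hk : k ≤ 0) : filt k = ⊥ := by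
  suffices h : degLT k = ⊥ by rw [filt, h, Submodule.map_bot]
  refine (Submodule.eq_bot_iff _).mpr fun f hf => ?_
  rw [← support_eq_empty]
  refine Finset.eq_empty_of_forall_notMem fun s hs => ?_
  have h1 := mem_degLT.mp hf s hs
  rw [deg_eq] at h1
  omega

theorem normalOrder_mem_filt {k : ℤ} {f : MvPolynomial (Fin 2) Rat2} :
    normalOrder f ∈ filt k ↔ f ∈ degLT k := by
  rw [filt, Submodule.mem_map]
  refine ⟨fun ⟨g, hg, h⟩ => normalOrder_injective h ▸ hg, fun h => ⟨f, h, rfl⟩⟩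

theorem normalOrder_monomial_mem_filt {k : ℤ} {s : Fin 2 →₀ ℕ} (hs : deg s < k) (a : Rat2) :
    normalOrder (monomial s a) ∈ filt k :=
  normalOrder_mem_filt.mpr <| mem_degLT.mpr fun t ht => by
    rwa [Finset.mem_singleton.mp (support_monomial_subset ht)]

theorem theta_mul_normalOrder_monomial (i : Fin 2) (s : Fin 2 →₀ ℕ) (a : Rat2) :
    theta i * normalOrder (monomial s a) = normalOrder (X i * monomial s a) +
      normalOrder (monomial s (coord i * partialD i a)) := by
  rw [X, monomial_mul, one_mul, normalOrder_monomial, normalOrder_monomial, normalOrder_monomial,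
    ← mul_assoc, theta_mul_ofRat, add_mul, mul_assoc]
  congr 2
  fin_cases i
  · simp [pow_succ', ← mul_assoc, pow_add]
  · simp only [Fin.mk_one, ← mul_assoc]
    rw [((commute_theta_theta 1 0).pow_right (s 0)).eq, mul_assoc, ← pow_succ']
    simp [add_comm]

theorem theta_mul_normalOrder (i : Fin 2) {k : ℤ} {g : MvPolynomial (Fin 2) Rat2}
    (hg : g ∈ degLT k) : theta i * normalOrder g - normalOrder (X i * g) ∈ filt k := by
  rw [g.as_sum, Finset.mul_sum, map_sum, map_sum, Finset.mul_sum, ← Finset.sum_sub_distrib]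
  refine Submodule.sum_mem _ fun s hs => ?_
  rw [theta_mul_normalOrder_monomial, add_sub_cancel_left]
  exact normalOrder_monomial_mem_filt (mem_degLT.mp hg s hs) _

theorem X_mem_degLT (i : Fin 2) : (X i : MvPolynomial (Fin 2) Rat2) ∈ degLT 2 :=
  degLT_mono one_add_one_eq_two.le (homog_le_degLT (X_mem_homog i))

theorem theta_mul_mem_filt (i : Fin 2) {k : ℤ} {w : W} (hw : w ∈ filt k) :
    theta i * w ∈ filt (k + 1) := by
  obtain ⟨g, hg, rfl⟩ := hw
  rw [← sub_add_cancel (theta i * normalOrder g) (normalOrder (X i * g))]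
  refine add_mem (filt_mono (by omega) (theta_mul_normalOrder i hg)) ?_
  rw [normalOrder_mem_filt]
  exact degLT_mono (by omega) (mul_mem_degLT (X_mem_degLT i) hg)

theorem theta_pow_mul_normalOrder (i : Fin 2) (n : ℕ) {k : ℤ} {g : MvPolynomial (Fin 2) Rat2}
    (hg : g ∈ degLT k) :
    theta i ^ n * normalOrder g - normalOrder (X i ^ n * g) ∈ filt (k + n - 1) := by
  induction n with
  | zero => simp
  | succ n ih =>
    have h1 : X i ^ n * g ∈ degLT (k + n) :=
      degLT_mono (by omega) (mul_mem_degLT (homog_le_degLT (pow_mem_homog (X_mem_homog i) n)) hg)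
    have h := add_mem (theta_mul_mem_filt i ih)
      (filt_mono (b := k + n - 1 + 1) (by omega) (theta_mul_normalOrder i h1))
    rw [mul_sub, sub_add_sub_cancel, ← mul_assoc, ← mul_assoc, ← pow_succ', ← pow_succ'] at h
    refine filt_mono ?_ h
    push_cast
    omega

/-- Moving `ϑ` past a coefficient costs only terms of lower order. The bounds are strict: `f * g`
has degree at most `a + b - 2`, and the error has order below that. -/
theorem normalOrder_mul_normalOrder {a b : ℤ} {f g : MvPolynomial (Fin 2) Rat2}
    (hf : f ∈ degLT a) (hg : g ∈ degLT b) :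
    normalOrder f * normalOrder g - normalOrder (f * g) ∈ filt (a + b - 2) := by
  rw [f.as_sum, Finset.sum_mul, map_sum, map_sum, Finset.sum_mul, ← Finset.sum_sub_distrib]
  refine Submodule.sum_mem _ fun s hs => ?_
  have hs' := mem_degLT.mp hf s hs
  rw [deg_eq] at hs'
  have e1 : X 1 ^ s 1 * g ∈ degLT (b + s 1) :=
    degLT_mono (by omega)
      (mul_mem_degLT (homog_le_degLT (pow_mem_homog (X_mem_homog 1) (s 1))) hg)
  have e2 := theta_pow_mul_normalOrder 1 (s 1) hg
  have e3 := theta_pow_mul_normalOrder 0 (s 0) e1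
  have e4 : ∀ n : ℕ, ∀ {k : ℤ} {w : W}, w ∈ filt k → theta 0 ^ n * w ∈ filt (k + n) := by
    intro n
    induction n with
    | zero => simp
    | succ n ih =>
      intro k w hw
      rw [pow_succ', mul_assoc]
      refine filt_mono ?_ (theta_mul_mem_filt 0 (ih hw))
      push_cast
      omega
  have h := add_mem (filt_mono (b := a + b - 2) (by omega) (e4 (s 0) e2))
    (filt_mono (b := a + b - 2) (by omega) e3)
  rw [mul_sub, sub_add_sub_cancel] at h
  have h' := Submodule.smul_mem _ (coeff s f) h
  have hm : monomial s (coeff s f) * g = coeff s f • (X 0 ^ s 0 * (X 1 ^ s 1 * g)) := by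
    rw [monomial_eq, Finsupp.prod_fintype _ _ (by simp), Fin.prod_univ_two, smul_eq_C_mul]
    ring
  rw [hm, map_smul, normalOrder_monomial, mul_assoc, mul_assoc, ← rat_smul_def, ← smul_sub]
  exact h'

theorem mul_mem_filt {a b : ℤ} {u v : W} (hu : u ∈ filt a) (hv : v ∈ filt b) :
    u * v ∈ filt (a + b - 1) := by
  obtain ⟨f, hf, rfl⟩ := hu
  obtain ⟨g, hg, rfl⟩ := hv
  rw [← sub_add_cancel (normalOrder f * normalOrder g) (normalOrder (f * g))]
  refine add_mem (filt_mono (by omega) (normalOrder_mul_normalOrder hf hg)) ?_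
  exact normalOrder_mem_filt.mpr (mul_mem_degLT hf hg)

/-- `HasSymbol k w f`: modulo operators of smaller order, `w` is the operator with homogeneous
symbol `f` of degree `k`. -/
structure HasSymbol (k : ℤ) (w : W) (f : MvPolynomial (Fin 2) Rat2) : Prop where
  mem_homog : f ∈ homog Rat2 k
  sub_mem : w - normalOrder f ∈ filt k

namespace HasSymbol

variable {k l : ℤ} {v w : W} {f g : MvPolynomial (Fin 2) Rat2}

theorem mem_filt (h : HasSymbol k w f) : w ∈ filt (k + 1) := by
  rw [← sub_add_cancel w (normalOrder f)]
  exact add_mem (filt_mono (by omega) h.sub_mem)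
    (normalOrder_mem_filt.mpr (homog_le_degLT h.mem_homog))

theorem eq_zero (h : HasSymbol k w f) (hw : w ∈ filt k) : f = 0 := by
  refine eq_zero_of_mem_homog_of_mem_degLT h.mem_homog (normalOrder_mem_filt.mp ?_)
  rw [← sub_sub_cancel w (normalOrder f)]
  exact _root_.sub_mem hw h.sub_mem

theorem mem_filt_of_zero (h : HasSymbol k w 0) : w ∈ filt k := by
  simpa using h.sub_mem

theorem add (hv : HasSymbol k v f) (hw : HasSymbol k w g) : HasSymbol k (v + w) (f + g) := by
  refine ⟨add_mem hv.mem_homog hw.mem_homog, ?_⟩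
  rw [map_add, add_sub_add_comm]
  exact add_mem hv.sub_mem hw.sub_mem

theorem neg (hv : HasSymbol k v f) : HasSymbol k (-v) (-f) := by
  refine ⟨neg_mem hv.mem_homog, ?_⟩
  rw [map_neg, ← neg_sub']
  exact neg_mem hv.sub_mem

theorem sub (hv : HasSymbol k v f) (hw : HasSymbol k w g) : HasSymbol k (v - w) (f - g) := by
  rw [sub_eq_add_neg, sub_eq_add_neg]
  exact hv.add hw.neg

theorem mul (hv : HasSymbol k v f) (hw : HasSymbol l w g) :
    HasSymbol (k + l) (v * w) (f * g) := by
  refine ⟨mul_mem_homog hv.mem_homog hw.mem_homog, ?_⟩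
  have h1 := mul_mem_filt hv.mem_filt hw.sub_mem
  have h2 := mul_mem_filt hv.sub_mem
    (normalOrder_mem_filt.mpr (homog_le_degLT hw.mem_homog))
  have h3 := normalOrder_mul_normalOrder (homog_le_degLT hv.mem_homog)
    (homog_le_degLT hw.mem_homog)
  have h := add_mem (add_mem (filt_mono (b := k + l) (by omega) h1)
    (filt_mono (b := k + l) (by omega) h2)) (filt_mono (b := k + l) (by omega) h3)
  rwa [mul_sub, sub_mul, sub_add_sub_cancel, sub_add_sub_cancel] at h

theorem congr (h : HasSymbol k w f) (hk : k = l) (hf : f = g) : HasSymbol l w g :=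
  hk ▸ hf ▸ h

end HasSymbol

/-- The symbol is taken relative to the bound `k`, so it is zero when the order of `w` is smaller.
-/
theorem exists_hasSymbol {k : ℤ} {w : W} (hw : w ∈ filt (k + 1)) : ∃ f, HasSymbol k w f := by
  obtain ⟨g, hg, rfl⟩ := hw
  refine ⟨_, weightedHomogeneousComponent_mem _ g k, ?_⟩
  rw [← map_sub]
  exact normalOrder_mem_filt.mpr (sub_weightedHomogeneousComponent_mem hg)

theorem hasSymbol_ofRat (a : Rat2) : HasSymbol 0 (ofRat a) (C a) := by
  refine ⟨C_mem_homog a, ?_⟩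
  have h : normalOrder (C a) = ofRat a := by
    rw [C_apply, normalOrder_monomial]
    simp
  rw [h, sub_self]
  exact zero_mem _

theorem hasSymbol_theta (i : Fin 2) : HasSymbol 1 (theta i) (X i) := by
  refine ⟨X_mem_homog i, ?_⟩
  have h : normalOrder (X i) = theta i := by
    rw [X, normalOrder_monomial]
    fin_cases i <;> simp
  rw [h, sub_self]
  exact zero_mem _

theorem hasSymbol_theta_add : HasSymbol 1 (theta 0 + theta 1) (X 0 + X 1) :=
  (hasSymbol_theta 0).add (hasSymbol_theta 1)

theorem algebraMap_W (c : ℂ) : algebraMap ℂ W c = ofRat (algebraMap ℂ Rat2 c) :=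
  (ofRat.commutes c).symm

theorem algebraMap_mem_filt (c : ℂ) : algebraMap ℂ W c ∈ filt 1 :=
  algebraMap_W c ▸ (hasSymbol_ofRat _).mem_filt

theorem hasSymbol_list_prod {f : MvPolynomial (Fin 2) Rat2} (l : List W)
    (h : ∀ w ∈ l, HasSymbol 1 w f) : HasSymbol l.length l.prod (f ^ l.length) := by
  induction l with
  | nil => simpa using hasSymbol_ofRat 1
  | cons w l ih =>
    have h1 := (h w (by simp)).mul (ih fun v hv => h v (by simp [hv]))
    refine (List.prod_cons (a := w) (l := l) ▸ h1).congr ?_ ?_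
    · simp [add_comm]
    · rw [List.length_cons, pow_succ']

/-- The constants have order zero and disappear from the symbol; this is why the rank does not
depend on the parameters. -/
theorem hasSymbol_addProd {T : W} {f : MvPolynomial (Fin 2) Rat2} (h : HasSymbol 1 T f) {n : ℕ}
    (a : Fin n → ℂ) : HasSymbol n (addProd T a) (f ^ n) := by
  have h1 := hasSymbol_list_prod (f := f) (List.ofFn fun i => T + algebraMap ℂ W (a i)) (by
    intro w hw
    obtain ⟨i, rfl⟩ := List.mem_ofFn.mp hw
    refine ⟨h.mem_homog, ?_⟩
    rw [add_sub_right_comm]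
    exact add_mem h.sub_mem (algebraMap_mem_filt _))
  rwa [List.length_ofFn] at h1

theorem subProd_eq_addProd {n : ℕ} (T : W) (a : Fin n → ℂ) :
    subProd T a = addProd T fun i => -a i := by
  simp [subProd, addProd, sub_eq_add_neg]

theorem hasSymbol_subProd {T : W} {f : MvPolynomial (Fin 2) Rat2} (h : HasSymbol 1 T f) {n : ℕ}
    (a : Fin n → ℂ) : HasSymbol n (subProd T a) (f ^ n) :=
  subProd_eq_addProd T a ▸ hasSymbol_addProd h _

theorem del_eq (i : Fin 2) : del i = ofRat (coord i)⁻¹ * theta i := by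
  rw [theta, ← mul_assoc, ← map_mul, inv_mul_cancel₀ (coord_ne_zero i), map_one, one_mul]

/-- The generators of `W` have order at most one, and orders stay bounded under sums and products.
-/
theorem exists_mem_filt (w : W) : ∃ n : ℕ, w ∈ filt n := by
  obtain ⟨w, hw⟩ := w
  induction hw using Algebra.adjoin_induction with
  | mem u hu =>
    obtain ⟨a, rfl⟩ | ⟨i, rfl⟩ := hu
    · exact ⟨1, (hasSymbol_ofRat a).mem_filt⟩
    · refine ⟨2, ?_⟩
      change del i ∈ filt 2
      rw [del_eq]
      exact ((hasSymbol_ofRat _).mul (hasSymbol_theta i)).mem_filt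
  | algebraMap c => exact ⟨1, algebraMap_mem_filt c⟩
  | add u v hu hv ihu ihv =>
    obtain ⟨m, hm⟩ := ihu
    obtain ⟨n, hn⟩ := ihv
    exact ⟨m + n, add_mem (filt_mono (by omega) hm) (filt_mono (by omega) hn)⟩
  | mul u v hu hv ihu ihv =>
    obtain ⟨m, hm⟩ := ihu
    obtain ⟨n, hn⟩ := ihv
    exact ⟨m + n, filt_mono (by omega) (mul_mem_filt hm hn)⟩

end

/-! ### Lifting syzygies from symbols to operators. -/

noncomputable section

/-- The orders of `P₁`, `P₂` and `P₁₂`. -/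
def degP (p q r q' : ℕ) : Fin 3 → ℤ := ![p + r, q + r, p + q']

/-- The orders of the entries of the first syzygy. -/
def degU (p' q' r : ℕ) : Fin 3 → ℤ := ![q', p', r]

/-- The orders of the entries of the second syzygy. -/
def degV (p q r' : ℕ) : Fin 3 → ℤ := ![q, p, r']

/-- Operators `P` whose symbols are those of the hypergeometric system, with two relations `U` and
`V` that lift the syzygies of the symbols. -/
structure LiftedSyzygies (p q r p' q' r' : ℕ) (P U V : Fin 3 → W) : Prop where
  hx : p + r = p' + r'
  hy : q + r = q' + r'
  hasSymbolP : ∀ i, HasSymbol (degP p q r q' i) (P i)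
    (symbolP (coord 0) (coord 1) p q r p' q' r' i)
  hasSymbolU : ∀ i, HasSymbol (degU p' q' r i) (U i) (symbolU p' q' r i)
  hasSymbolV : ∀ i, HasSymbol (degV p q r' i) (V i) (symbolV (coord 0) (coord 1) p q r' i)
  sumU : ∑ i, U i * P i = 0
  sumV : ∑ i, V i * P i = 0

namespace LiftedSyzygies

variable {p q r p' q' r' : ℕ} {P U V : Fin 3 → W}

theorem degP_add_degU (h : LiftedSyzygies p q r p' q' r' P U V) (i : Fin 3) :
    degP p q r q' i + degU p' q' r i = p + r + q' := by
  have hx := h.hx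
  have hy := h.hy
  fin_cases i <;> simp [degP, degU] <;> omega

theorem degP_add_degV (h : LiftedSyzygies p q r p' q' r' P U V) (i : Fin 3) :
    degP p q r q' i + degV p q r' i = p + q + r := by
  have hx := h.hx
  have hy := h.hy
  fin_cases i <;> simp [degP, degV] <;> omega

theorem sum_columns_mul (h : LiftedSyzygies p q r p' q' r' P U V) (b c : W) :
    ∑ i, (b * U i + c * V i) * P i = 0 := by
  simp only [add_mul, mul_assoc, Finset.sum_add_distrib, ← Finset.mul_sum, h.sumU, h.sumV,
    mul_zero, add_zero]

theorem columns_mem_filt (h : LiftedSyzygies p q r p' q' r' P U V) {n : ℤ} {b c : W}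
    (hb : b ∈ filt (n - (p + r + q'))) (hc : c ∈ filt (n - (p + q + r))) (i : Fin 3) :
    b * U i + c * V i ∈ filt (n - degP p q r q' i) := by
  have h1 := h.degP_add_degU i
  have h2 := h.degP_add_degV i
  exact add_mem (filt_mono (by omega) (mul_mem_filt hb (h.hasSymbolU i).mem_filt))
    (filt_mono (by omega) (mul_mem_filt hc (h.hasSymbolV i).mem_filt))

theorem hasSymbol_columns (h : LiftedSyzygies p q r p' q' r' P U V) {n : ℤ} {b c : W}
    {f g : MvPolynomial (Fin 2) Rat2} (hb : HasSymbol (n - (p + r + q')) b f)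
    (hc : HasSymbol (n - (p + q + r)) c g) (i : Fin 3) :
    HasSymbol (n - degP p q r q' i) (b * U i + c * V i)
      (f * symbolU p' q' r i + g * symbolV (coord 0) (coord 1) p q r' i) := by
  have h1 := h.degP_add_degU i
  have h2 := h.degP_add_degV i
  exact ((hb.mul (h.hasSymbolU i)).congr (by omega) rfl).add
    ((hc.mul (h.hasSymbolV i)).congr (by omega) rfl)

/-- If the leading terms cancel in `∑ Aᵢ Pᵢ`, then the orders of the `Aᵢ` can be lowered. -/
theorem exists_lower (h : LiftedSyzygies p q r p' q' r' P U V) (n : ℤ) (A : Fin 3 → W)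
    (hA : ∀ i, A i ∈ filt (n + 1 - degP p q r q' i)) (hP : ∑ i, A i * P i ∈ filt n) :
    ∃ b ∈ filt (n + 1 - (p + r + q')), ∃ c ∈ filt (n + 1 - (p + q + r)),
      ∀ i, A i - (b * U i + c * V i) ∈ filt (n - degP p q r q' i) := by
  have hf (i : Fin 3) : ∃ f, HasSymbol (n - degP p q r q' i) (A i) f :=
    exists_hasSymbol (by rw [← add_sub_right_comm]; exact hA i)
  choose f hf using hf
  have hs (i : Fin 3) := ((hf i).mul (h.hasSymbolP i)).congr (sub_add_cancel n _) rfl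
  -- The sum has order less than `n`, so the degree `n` symbols cancel: the `f i` form a homogeneous
  -- syzygy, whose coefficients are then lifted by `normalOrder`.
  have h0 := (((hs 0).add (hs 1)).add (hs 2)).eq_zero (by rwa [Fin.sum_univ_three] at hP)
  obtain ⟨a, ha, b, hb, hab⟩ := exists_symbol_syzygy algebraicIndependent_coord h.hx h.hy f n
    (hf 0).mem_homog (hf 1).mem_homog (hf 2).mem_homog h0
  have symb {k : ℤ} {g : MvPolynomial (Fin 2) Rat2} (hg : g ∈ homog Rat2 k) :
      HasSymbol k (normalOrder g) g := ⟨hg, by rw [sub_self]; exact zero_mem _⟩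
  refine ⟨_, by rw [add_sub_right_comm]; exact (symb ha).mem_filt, _,
    by rw [add_sub_right_comm]; exact (symb hb).mem_filt, fun i => ?_⟩
  exact (((hf i).sub (h.hasSymbol_columns (symb ha) (symb hb) i)).congr rfl
    (sub_eq_zero.mpr (hab i))).mem_filt_of_zero

theorem degP_nonneg (p q r q' : ℕ) (i : Fin 3) : 0 ≤ degP p q r q' i := by
  fin_cases i <;> simp [degP] <;> omega

/-- The relations between the `Pᵢ` are generated by `U` and `V`, with bounds on the orders. -/
theorem exists_columns_eq (h : LiftedSyzygies p q r p' q' r' P U V) (n : ℕ) (A : Fin 3 → W)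
    (hA : ∀ i, A i ∈ filt (n - degP p q r q' i)) (hP : ∑ i, A i * P i = 0) :
    ∃ b ∈ filt (n - (p + r + q')), ∃ c ∈ filt (n - (p + q + r)),
      ∀ i, A i = b * U i + c * V i := by
  induction n generalizing A with
  | zero =>
    refine ⟨0, zero_mem _, 0, zero_mem _, fun i => ?_⟩
    have h1 := hA i
    have := degP_nonneg p q r q' i
    rw [filt_of_nonpos (by omega), Submodule.mem_bot] at h1
    simpa using h1
  | succ n ih =>
    push_cast at hA ⊢
    obtain ⟨b, hb, c, hc, hbc⟩ := h.exists_lower n A hA (hP ▸ zero_mem _)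
    obtain ⟨b', hb', c', hc', hbc'⟩ := ih _ hbc (by
      simp only [sub_mul (A _), Finset.sum_sub_distrib, hP, h.sum_columns_mul, sub_zero])
    refine ⟨b + b', add_mem hb (filt_mono (by omega) hb'), c + c',
      add_mem hc (filt_mono (by omega) hc'), fun i => ?_⟩
    rw [← sub_add_cancel (A i) (b * U i + c * V i), hbc' i]
    noncomm_ring

/-- An element of order less than `n` of the left ideal is `∑ Aᵢ Pᵢ` without cancellation of
leading terms. -/
theorem exists_bounded (h : LiftedSyzygies p q r p' q' r' P U V) (n m : ℕ) (A : Fin 3 → W)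
    (hA : ∀ i, A i ∈ filt (n + m - degP p q r q' i)) (hP : ∑ i, A i * P i ∈ filt n) :
    ∃ A' : Fin 3 → W, (∀ i, A' i ∈ filt (n - degP p q r q' i)) ∧
      ∑ i, A' i * P i = ∑ i, A i * P i := by
  induction m generalizing A with
  | zero => exact ⟨A, by simpa using hA, rfl⟩
  | succ m ih =>
    -- Subtracting a combination of `U` and `V` leaves the sum unchanged and lowers the excess `m`
    -- by one.
    obtain ⟨b, -, c, -, hbc⟩ := h.exists_lower (n + m) A
      (fun i => by simpa [add_assoc] using hA i) (filt_mono (by omega) hP)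
    have h1 : ∑ i, (A i - (b * U i + c * V i)) * P i = ∑ i, A i * P i := by
      simp only [sub_mul (A _), Finset.sum_sub_distrib, h.sum_columns_mul, sub_zero]
    obtain ⟨A', h2, h3⟩ := ih _ hbc (h1 ▸ hP)
    exact ⟨A', h2, h3.trans h1⟩

/-- The symbols of `b` and `c` satisfy a relation between independent columns, so both orders drop,
down to a bound where the filtration is zero. -/
theorem columns_injective (h : LiftedSyzygies p q r p' q' r' P U V) (n : ℕ) (b c : W)
    (hb : b ∈ filt (n - (p + r + q'))) (hc : c ∈ filt (n - (p + q + r)))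
    (hbc : ∀ i, b * U i + c * V i = 0) : b = 0 ∧ c = 0 := by
  induction n with
  | zero =>
    rw [filt_of_nonpos (by omega), Submodule.mem_bot] at hb hc
    exact ⟨hb, hc⟩
  | succ n ih =>
    obtain ⟨f, hf⟩ := exists_hasSymbol (k := n - (p + r + q')) (filt_mono (by omega) hb)
    obtain ⟨g, hg⟩ := exists_hasSymbol (k := n - (p + q + r)) (filt_mono (by omega) hc)
    obtain ⟨rfl, rfl⟩ := symbol_columns_independent algebraicIndependent_coord h.hx h.hy f g
      fun i => (h.hasSymbol_columns hf hg i).eq_zero (hbc i ▸ zero_mem _)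
    exact ih hf.mem_filt_of_zero hg.mem_filt_of_zero

end LiftedSyzygies

end

/-! ### The dimension count. -/

noncomputable section

/-- The monomials of degree less than `n`, indexed by the degree and the exponent of `x`. -/
def degLTEquiv (n : ℕ) : {s : Fin 2 →₀ ℕ | deg s < n} ≃ Σ k : Fin n, Fin (k + 1) where
  toFun s := ⟨⟨s.1 0 + s.1 1, by have := s.2; rw [Set.mem_ofPred_eq, deg_eq] at this; omega⟩,
    ⟨s.1 0, by simp⟩⟩
  invFun t := ⟨Finsupp.equivFunOnFinite.symm ![t.2, t.1 - t.2], by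
    have h1 := t.1.2
    have h2 := t.2.2
    rw [Set.mem_ofPred_eq, deg_eq]
    simp
    omega⟩
  left_inv s := by
    ext i
    fin_cases i <;> simp
  right_inv t := by
    obtain ⟨⟨k, hk⟩, ⟨i, hi⟩⟩ := t
    have h : i + (k - i) = k := by
      dsimp only at hi
      omega
    refine Sigma.ext (Fin.ext h) ((Fin.heq_ext_iff ?_).mpr rfl)
    exact congrArg (· + 1) h

theorem degLT_toNat (k : ℤ) : degLT k.toNat = degLT k := by
  ext f
  simp only [mem_degLT]
  refine forall₂_congr fun s _ => ?_
  have := deg_eq s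
  omega

/-- A basis of the space of operators of order less than `n`. -/
def filtBasis (n : ℕ) : Module.Basis (Σ k : Fin n, Fin (k + 1)) Rat2 (filt n) :=
  ((basisRestrictSupport Rat2 {s | deg s < n}).reindex (degLTEquiv n)).map
    (Submodule.equivMapOfInjective normalOrder normalOrder_injective (degLT n))

instance finite_filt (k : ℤ) : Module.Finite Rat2 (filt k) := by
  rw [filt, ← degLT_toNat]
  exact Module.Finite.of_basis (filtBasis k.toNat)

theorem two_mul_finrank_filt {k : ℤ} (hk : 0 ≤ k) :
    2 * (Module.finrank Rat2 (filt k) : ℤ) = k * (k + 1) := by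
  obtain ⟨n, rfl⟩ := Int.eq_ofNat_of_zero_le hk
  have h (n : ℕ) : 2 * ((∑ k : Fin n, ((k : ℕ) + 1) : ℕ) : ℤ) = n * (n + 1) := by
    induction n with
    | zero => simp
    | succ n ih =>
      rw [Fin.sum_univ_castSucc]
      push_cast at ih ⊢
      simp only [Fin.val_castSucc]
      linear_combination ih
  rw [Module.finrank_eq_card_basis (filtBasis n), Fintype.card_sigma]
  simpa using h n

/-- The map `(A₁, A₂, A₃) ↦ ∑ Aᵢ Pᵢ` on tuples of bounded order. -/
def combP (P : Fin 3 → W) (d : Fin 3 → ℤ) (n : ℤ) : (∀ i, filt (n - d i)) →ₗ[Rat2] W where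
  toFun A := ∑ i, (A i : W) * P i
  map_add' A B := by simp [add_mul, Finset.sum_add_distrib]
  map_smul' a A := by simp [rat_smul_def, mul_assoc, Finset.mul_sum]

namespace LiftedSyzygies

variable {p q r p' q' r' : ℕ} {P U V : Fin 3 → W}

/-- The map `(B, C) ↦ B U + C V` on pairs of bounded order. -/
def combUV (h : LiftedSyzygies p q r p' q' r' P U V) (n : ℤ) :
    (filt (n - (p + r + q')) × filt (n - (p + q + r))) →ₗ[Rat2]
      ∀ i, filt (n - degP p q r q' i) where
  toFun B := fun i => ⟨B.1 * U i + B.2 * V i, h.columns_mem_filt B.1.2 B.2.2 i⟩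
  map_add' B C := by
    ext i
    simp [add_mul]
    abel
  map_smul' a B := by
    ext i
    simp [rat_smul_def, mul_assoc]

theorem ker_combP (h : LiftedSyzygies p q r p' q' r' P U V) (n : ℕ) :
    (combP P (degP p q r q') n).ker = (h.combUV n).range := by
  ext A
  rw [LinearMap.mem_ker, LinearMap.mem_range]
  constructor
  · intro hA
    obtain ⟨b, hb, c, hc, hbc⟩ := h.exists_columns_eq n (fun i => A i) (fun i => (A i).2) hA
    exact ⟨(⟨b, hb⟩, ⟨c, hc⟩), funext fun i => Subtype.ext (hbc i).symm⟩
  · rintro ⟨B, rfl⟩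
    exact h.sum_columns_mul B.1 B.2

theorem combUV_injective (h : LiftedSyzygies p q r p' q' r' P U V) (n : ℕ) :
    Function.Injective (h.combUV n) := by
  rw [injective_iff_map_eq_zero]
  rintro ⟨b, c⟩ hbc
  obtain ⟨h1, h2⟩ := h.columns_injective n b c b.2 c.2
    fun i => congrArg Subtype.val (congrFun hbc i)
  exact Prod.ext (Subtype.ext h1) (Subtype.ext h2)

/-- Rank–nullity for `combP`, whose kernel is a copy of the space of pairs `(B, C)`. -/
theorem finrank_range_combP (h : LiftedSyzygies p q r p' q' r' P U V) (n : ℕ) :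
    Module.finrank Rat2 (combP P (degP p q r q') n).range +
      (Module.finrank Rat2 (filt (n - (p + r + q'))) +
        Module.finrank Rat2 (filt (n - (p + q + r)))) =
    Module.finrank Rat2 (filt (n - (p + r))) + Module.finrank Rat2 (filt (n - (q + r))) +
      Module.finrank Rat2 (filt (n - (p + q'))) := by
  have h1 := LinearMap.finrank_range_add_finrank_ker (combP P (degP p q r q') n)
  rw [h.ker_combP, LinearMap.finrank_range_of_inj (h.combUV_injective n), Module.finrank_prod,
    Module.finrank_pi_fintype, Fin.sum_univ_three] at h1
  exact h1

/-- The left ideal generated by the `Pᵢ`, as a `K`-subspace. -/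
def ideal (P : Fin 3 → W) : Submodule W W := Submodule.span W (Set.range P)

theorem mem_ideal {w : W} : w ∈ ideal P ↔ ∃ A : Fin 3 → W, ∑ i, A i * P i = w :=
  Submodule.mem_span_range_iff_exists_fun W

/-- The operators of order less than `n`, modulo the left ideal. -/
def filtQuot (P : Fin 3 → W) (n : ℤ) : filt n →ₗ[Rat2] W ⧸ ideal P :=
  ((ideal P).mkQ.restrictScalars Rat2).comp (filt n).subtype

/-- The inclusion from left to right is the absence of cancellation: an ideal element of order less
than `n` has a representation with each `Aᵢ Pᵢ` of order less than `n`. -/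
theorem map_ker_filtQuot (h : LiftedSyzygies p q r p' q' r' P U V) (n : ℕ) :
    (filtQuot P n).ker.map (filt n).subtype = (combP P (degP p q r q') n).range := by
  ext w
  constructor
  · rintro ⟨w, hw, rfl⟩
    obtain ⟨A, hA⟩ := mem_ideal.mp ((Submodule.Quotient.mk_eq_zero _).mp hw)
    choose k hk using fun i => exists_mem_filt (A i)
    have hle (i : Fin 3) : (k i : ℤ) ≤ ∑ j, (k j : ℤ) :=
      Finset.single_le_sum (f := fun j => (k j : ℤ)) (fun j _ => by simp) (Finset.mem_univ i)
    have hle' (i : Fin 3) : degP p q r q' i ≤ ∑ j, degP p q r q' j :=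
      Finset.single_le_sum (f := degP p q r q') (fun j _ => degP_nonneg p q r q' j) (Finset.mem_univ i)
    obtain ⟨m, hm⟩ : ∃ m : ℕ, ∑ j, (k j : ℤ) + ∑ j, degP p q r q' j = m :=
      Int.eq_ofNat_of_zero_le (add_nonneg (Finset.sum_nonneg fun j _ => Nat.cast_nonneg (k j))
        (Finset.sum_nonneg fun j _ => degP_nonneg p q r q' j))
    obtain ⟨A', h1, h2⟩ := h.exists_bounded n m A
      (fun i => filt_mono (by have := hle i; have := hle' i; omega) (hk i)) (hA ▸ w.2)
    exact ⟨fun i => ⟨A' i, h1 i⟩, h2.trans hA⟩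
  · rintro ⟨A, rfl⟩
    have hmem : combP P (degP p q r q') n A ∈ filt n := by
      change ∑ i, (A i : W) * P i ∈ filt n
      refine Submodule.sum_mem _ fun i _ => ?_
      exact filt_mono (by omega) (mul_mem_filt (A i).2 (h.hasSymbolP i).mem_filt)
    refine ⟨⟨_, hmem⟩, (Submodule.Quotient.mk_eq_zero _).mpr ?_, rfl⟩
    exact mem_ideal.mpr ⟨fun i => A i, rfl⟩

/-- In the alternating sum of the six quadratic dimension formulas the terms in `n` cancel. The
bound on `n` keeps all shifted indices nonnegative, where these formulas are valid. -/
theorem finrank_range_filtQuot (h : LiftedSyzygies p q r p' q' r' P U V) (n : ℕ)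
    (hn : p + q + r + q' ≤ n) :
    (Module.finrank Rat2 (filtQuot P n).range : ℤ) =
      p * q + p * r + q * r + (r - r') * r := by
  have h1 := LinearMap.finrank_range_add_finrank_ker (filtQuot P n)
  rw [← Submodule.finrank_map_subtype_eq, h.map_ker_filtQuot] at h1
  have h2 := h.finrank_range_combP n
  have hx := h.hx
  have hy := h.hy
  have a0 := two_mul_finrank_filt (k := n) (by omega)
  have a1 := two_mul_finrank_filt (k := n - (p + r)) (by omega)
  have a2 := two_mul_finrank_filt (k := n - (q + r)) (by omega)
  have a3 := two_mul_finrank_filt (k := n - (p + q')) (by omega)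
  have b1 := two_mul_finrank_filt (k := n - (p + r + q')) (by omega)
  have b2 := two_mul_finrank_filt (k := n - (p + q + r)) (by omega)
  zify at h1 h2 hy
  apply mul_left_cancel₀ (two_ne_zero' ℤ)
  linear_combination 2 * h1 - 2 * h2 + a0 - a1 - a2 - a3 + b1 + b2 - 2 * r * hy

theorem range_filtQuot_mono {m n : ℤ} (hmn : m ≤ n) :
    (filtQuot P m).range ≤ (filtQuot P n).range := by
  rintro _ ⟨w, rfl⟩
  exact ⟨⟨w, filt_mono hmn w.2⟩, rfl⟩

/-- The images increase with `n` and have constant dimension from this bound on, so they are already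
everything. -/
theorem range_filtQuot_eq_top (h : LiftedSyzygies p q r p' q' r' P U V) :
    (filtQuot P (p + q + r + q' : ℕ)).range = ⊤ := by
  refine (Submodule.eq_top_iff').mpr fun w => ?_
  obtain ⟨w, rfl⟩ := (ideal P).mkQ_surjective w
  obtain ⟨n, hn⟩ := exists_mem_filt w
  have hle : (filtQuot P (p + q + r + q' : ℕ)).range ≤
      (filtQuot P (p + q + r + q' + n : ℕ)).range := range_filtQuot_mono (by omega)
  have heq := Submodule.eq_of_le_of_finrank_eq hle (by
    have h1 := h.finrank_range_filtQuot _ le_rfl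
    have h2 := h.finrank_range_filtQuot (p + q + r + q' + n) (by omega)
    omega)
  rw [heq]
  exact ⟨⟨w, filt_mono (by omega) hn⟩, rfl⟩

/-- The dimension of the quotient by the left ideal. -/
theorem finrank_quotient (h : LiftedSyzygies p q r p' q' r' P U V) :
    Module.Finite Rat2 (W ⧸ ideal P) ∧
      (Module.finrank Rat2 (W ⧸ ideal P) : ℤ) = p * q + p * r + q * r + (r - r') * r := by
  have h1 := h.range_filtQuot_eq_top
  refine ⟨Module.Finite.of_surjective _ (LinearMap.range_eq_top.mp h1), ?_⟩
  rw [← h.finrank_range_filtQuot _ le_rfl, h1, finrank_top]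

end LiftedSyzygies

end

/-! ### The operator relations and the rank formula. -/

noncomputable section

theorem semiconjBy_addProd {z S T : W} (h : SemiconjBy z S T) {n : ℕ} (a : Fin n → ℂ) :
    SemiconjBy z (addProd S a) (addProd T a) := by
  induction n with
  | zero => simp [addProd]
  | succ n ih =>
    have e (T : W) : addProd T a = (T + algebraMap ℂ W (a 0)) * addProd T fun i => a i.succ := by
      simp [addProd]
    rw [e, e]
    exact (h.add_right (Algebra.commute_algebraMap_right _ _)).mul_right (ih _)

theorem commute_addProd {z T : W} (h : Commute z T) {n : ℕ} (a : Fin n → ℂ) :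
    Commute z (addProd T a) := semiconjBy_addProd h a

theorem commute_subProd {z T : W} (h : Commute z T) {n : ℕ} (a : Fin n → ℂ) :
    Commute z (subProd T a) := subProd_eq_addProd T a ▸ commute_addProd h _

theorem semiconjBy_subProd {z S T : W} (h : SemiconjBy z S T) {n : ℕ} (a : Fin n → ℂ) :
    SemiconjBy z (subProd S a) (subProd T a) := by
  rw [subProd_eq_addProd, subProd_eq_addProd]
  exact semiconjBy_addProd h _

theorem commute_coord_theta {i j : Fin 2} (h : j ≠ i) :
    Commute (ofRat (coord j)) (theta i) := by
  have := theta_mul_coord i j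
  rw [if_neg h, add_zero] at this
  exact this.symm

/-- Both coordinates shift `ϑ_x + ϑ_y` by the same constant, so a single shifted factor `c₁` serves
both terms of `P₁₂` in the relations between minors. -/
theorem semiconjBy_coord_theta_add (j : Fin 2) :
    SemiconjBy (ofRat (coord j)) (theta 0 + theta 1) (theta 0 + theta 1 - 1) := by
  rw [SemiconjBy, sub_mul, add_mul, theta_mul_coord, theta_mul_coord, one_mul, ← mul_add]
  fin_cases j <;> simp [mul_add] <;> abel

theorem hasSymbol_theta_add_sub_one :
    HasSymbol 1 (theta 0 + theta 1 - 1) (X 0 + X 1) := by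
  refine ⟨hasSymbol_theta_add.mem_homog, ?_⟩
  rw [sub_right_comm]
  refine sub_mem hasSymbol_theta_add.sub_mem ?_
  simpa using algebraMap_mem_filt 1

/-- The relations between the maximal minors of a `3 × 2` matrix of operators whose entries
commute up to twists. -/
theorem minors_relation₁ {R : Type*} [Ring R] {x y a b c a' b' c' c₁ : R}
    (hac : Commute a c) (hbc : Commute b c) (hab' : Commute a b') (hba' : Commute b a')
    (hca' : Commute c a') (hcb' : Commute c b') (ha'b' : Commute a' b')
    (hb'x : Commute b' x) (ha'y : Commute a' y) (hx : c₁ * x = x * c) (hy : c₁ * y = y * c) :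
    b' * (a' * c' - x * a * c) + -a' * (b' * c' - y * b * c) +
      c₁ * (x * a * b' - y * b * a') = 0 := by
  have t1 : b' * (a' * c') = a' * (b' * c') := ha'b'.symm.left_comm c'
  have t2 : b' * (x * a * c) = c₁ * (x * a * b') := by
    rw [mul_assoc x, mul_assoc x, hb'x.left_comm, ← mul_assoc c₁, hx, mul_assoc, hab'.symm.left_comm,
      hcb'.symm.eq, hac.left_comm]
  have t3 : a' * (y * b * c) = c₁ * (y * b * a') := by
    rw [mul_assoc y, mul_assoc y, ha'y.left_comm, ← mul_assoc c₁, hy, mul_assoc, hba'.symm.left_comm,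
      hca'.symm.eq, hbc.left_comm]
  rw [mul_sub, mul_sub, mul_sub, neg_mul, neg_mul, t1, t2, t3]
  abel

/-- The new point compared with the first column is that `y * b` and `x * a` must be interchanged,
which works because each Euler operator commutes with the other coordinate. -/
theorem minors_relation₂ {R : Type*} [Ring R] {x y a b c a' b' c' c₁ : R}
    (hab : Commute a b) (hac' : Commute a c') (hbc' : Commute b c')
    (ha'c' : Commute a' c') (hb'c' : Commute b' c')
    (hbx : Commute b x) (hay : Commute a y) (hxy : Commute x y)
    (hx : c₁ * x = x * c') (hy : c₁ * y = y * c') :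
    y * b * (a' * c' - x * a * c) + -(x * a) * (b' * c' - y * b * c) +
      c₁ * (x * a * b' - y * b * a') = 0 := by
  have t1 : y * b * (a' * c') = c₁ * (y * b * a') := by
    rw [mul_assoc, mul_assoc y, ← mul_assoc c₁, hy, mul_assoc, ha'c'.eq, hbc'.left_comm]
  have t2 : x * a * (b' * c') = c₁ * (x * a * b') := by
    rw [mul_assoc, mul_assoc x, ← mul_assoc c₁, hx, mul_assoc, hb'c'.eq, hac'.left_comm]
  have t3 : y * b * (x * a * c) = x * a * (y * b * c) := by
    rw [mul_assoc x, mul_assoc y, hbx.left_comm, mul_assoc x, mul_assoc y, hay.left_comm,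
      hxy.left_comm, hab.left_comm]
  rw [mul_sub, mul_sub, mul_sub, neg_mul, neg_mul, t1, t2, t3]
  abel

variable {p q r p' q' r' : ℕ}

theorem liftedSyzygies (hx : p + r = p' + r') (hy : q + r = q' + r')
    (α : Fin p → ℂ) (β : Fin q → ℂ) (γ : Fin r → ℂ)
    (α' : Fin p' → ℂ) (β' : Fin q' → ℂ) (γ' : Fin r' → ℂ) :
    LiftedSyzygies p q r p' q' r' ![opP1 α γ α' γ', opP2 β γ β' γ', opP12 α β α' β']
      ![subProd (theta 1) β', -subProd (theta 0) α', addProd (theta 0 + theta 1 - 1) γ]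
      ![ofRat (coord 1) * addProd (theta 1) β, -(ofRat (coord 0) * addProd (theta 0) α),
        subProd (theta 0 + theta 1 - 1) γ'] := by
  have h01 := commute_theta
  have hxy : Commute (ofRat (coord 0)) (ofRat (coord 1)) := by
    rw [Commute, SemiconjBy, ← map_mul, ← map_mul, mul_comm]
  have h0s : Commute (theta 0) (theta 0 + theta 1) := (Commute.refl _).add_right h01
  have h1s : Commute (theta 1) (theta 0 + theta 1) := h01.symm.add_right (Commute.refl _)
  have ya : Commute (ofRat (coord 1)) (theta 0) := commute_coord_theta (by decide)
  have xb : Commute (ofRat (coord 0)) (theta 1) := commute_coord_theta (by decide)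
  have sx {n : ℕ} {i : Fin 2} {T : W} (a : Fin n → ℂ) (hT : HasSymbol 1 T (X i)) (j : Fin 2) :
      HasSymbol n (ofRat (coord j) * addProd T a) (C (coord j) * X i ^ n) :=
    ((hasSymbol_ofRat _).mul (hasSymbol_addProd hT a)).congr (zero_add _) rfl
  have aa := hasSymbol_subProd (hasSymbol_theta 0) α'
  have bb := hasSymbol_subProd (hasSymbol_theta 1) β'
  have cc := hasSymbol_subProd hasSymbol_theta_add γ'
  have c := hasSymbol_addProd hasSymbol_theta_add γ
  have xa := sx α (hasSymbol_theta 0) 0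
  have yb := sx β (hasSymbol_theta 1) 1
  refine ⟨hx, hy, fun i => ?_, fun i => ?_, fun i => ?_, ?_, ?_⟩
  · fin_cases i
    · exact ((aa.mul cc).congr (by simp [degP]; omega) rfl).sub ((xa.mul c).congr rfl rfl)
    · exact ((bb.mul cc).congr (by simp [degP]; omega) rfl).sub ((yb.mul c).congr rfl rfl)
    · exact ((xa.mul bb).congr rfl rfl).sub ((yb.mul aa).congr (by omega) rfl)
  · fin_cases i
    exacts [bb, aa.neg, hasSymbol_addProd hasSymbol_theta_add_sub_one γ]
  · fin_cases i
    exacts [yb, xa.neg, hasSymbol_subProd hasSymbol_theta_add_sub_one γ']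
  · rw [Fin.sum_univ_three]
    exact minors_relation₁
      (commute_addProd (commute_addProd h0s.symm _).symm _)
      (commute_addProd (commute_addProd h1s.symm _).symm _)
      (commute_subProd (commute_addProd h01.symm _).symm _)
      (commute_subProd (commute_addProd h01 _).symm _)
      (commute_subProd (commute_addProd h0s _).symm _)
      (commute_subProd (commute_addProd h1s _).symm _)
      (commute_subProd (commute_subProd h01.symm _).symm _)
      (commute_subProd xb _).symm (commute_subProd ya _).symm
      (semiconjBy_addProd (semiconjBy_coord_theta_add 0) γ).eq.symm
      (semiconjBy_addProd (semiconjBy_coord_theta_add 1) γ).eq.symm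
  · rw [Fin.sum_univ_three]
    exact minors_relation₂
      (commute_addProd (commute_addProd h01.symm _).symm _)
      (commute_subProd (commute_addProd h0s.symm _).symm _)
      (commute_subProd (commute_addProd h1s.symm _).symm _)
      (commute_subProd (commute_subProd h0s.symm _).symm _)
      (commute_subProd (commute_subProd h1s.symm _).symm _)
      (commute_addProd xb _).symm (commute_addProd ya _).symm hxy
      (semiconjBy_subProd (semiconjBy_coord_theta_add 0) γ').eq.symm
      (semiconjBy_subProd (semiconjBy_coord_theta_add 1) γ').eq.symm

/-- Eliminating `p'` and `q'` makes the division by `L` exact; for `L = 0` the last term vanishes.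
-/
theorem rankNumber_eq (hx : p + r = p' + r') (hy : q + r = q' + r') :
    rankNumber p q r p' q' r' = p * q + p * r + q * r + (r - r') * r := by
  have hx' : (p' : ℚ) = p + r - r' := by rw [eq_sub_iff_add_eq]; exact_mod_cast hx.symm
  have hy' : (q' : ℚ) = q + r - r' := by rw [eq_sub_iff_add_eq]; exact_mod_cast hy.symm
  have hL : ((level r r' : ℤ) : ℚ) = r - r' := by simp [level]
  rw [rankNumber]
  split_ifs with h
  · rw [h, Int.cast_zero] at hL
    rw [← hL]
    ring
  · rw [div_eq_iff (Int.cast_ne_zero.mpr h), hL, hx', hy']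
    ring

end

end HGSystem

theorem mainTheorem1 (p q r p' q' r' : ℕ) (hx : p + r = p' + r') (hy : q + r = q' + r')
    (α : Fin p → ℂ) (β : Fin q → ℂ) (γ : Fin r → ℂ)
    (α' : Fin p' → ℂ) (β' : Fin q' → ℂ) (γ' : Fin r' → ℂ) :
    FiniteDimensional HGSystem.Rat2 (HGSystem.SystemModule α β γ α' β' γ') ∧
      (Module.finrank HGSystem.Rat2 (HGSystem.SystemModule α β γ α' β' γ') : ℚ) =
        HGSystem.rankNumber p q r p' q' r' := by
  have h := (HGSystem.liftedSyzygies hx hy α β γ α' β' γ').finrank_quotient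
  have hI : HGSystem.LiftedSyzygies.ideal ![HGSystem.opP1 α γ α' γ', HGSystem.opP2 β γ β' γ',
      HGSystem.opP12 α β α' β'] = HGSystem.systemIdeal α β γ α' β' γ' := by
    rw [HGSystem.LiftedSyzygies.ideal, HGSystem.systemIdeal, Matrix.range_cons,
      Matrix.range_cons_cons_empty, Set.singleton_union]
  rw [hI] at h
  refine ⟨h.1, ?_⟩
  rw [HGSystem.rankNumber_eq hx hy]
  exact_mod_cast h.2
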